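/- Let $A$ be an arbitrary (possibly infinite) nonempty set. An operation on $A$ is a map $f\colon A^n\to A$ with $n\ge 1$. For a set $X$, let $\mathcal M(X)$ be the set of finite multisets on $X$, with $\uplus$ the sum of multisets (multiplicities add), $\subseteq$ multiset inclusion and $\varepsilon$ the empty multiset. For $m\ge 1$, an $m$-ary system of pointed multisets (system, for short) is a pair $(\Phi,\Phi')$ with $\Phi\subseteq\mathcal M(A^m)$ and $\Phi'\subseteq A^m\times\mathcal M(A^m)$ such that $(x,S)\in\Phi'$ and $S'\subseteq S$ imply $(x,S')\in\Phi'$, and $(x,S)\in\Phi'$ implies $\{x\}\uplus S\in\Phi$. Inclusions, unions and intersections of such pairs are componentwise. A matrix $M\in A^{m\times n}$ is the tuple $(a^1,\dots,a^n)$ of its columns $a^i\in A^m$, $n\ge 0$. Write $M\prec\Phi$ if the multiset $\{a^1,\dots,a^n\}$ of columns lies in $\Phi$, and, for $n\ge1$, write $M\prec\Phi'$ if $(a^1,\{a^2,\dots,a^n\})\in\Phi'$. An operation $f\colon A^n\to A$ preserves $(\Phi,\Phi')$ if for all matrices $M_1$ with $m$ rows and $n$ columns and $M_2$ with $m$ rows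 and $k\ge 0$ columns, $[M_1|M_2]\prec\Phi$ implies $[fM_1|M_2]\prec\Phi'$, where $fM_1\in A^m$ is obtained by applying $f$ to the rows of $M_1$. A set $W$ of systems is characterized by a set $F$ of operations if $W$ is the set of all systems that are preserved by every member of $F$. For $p\ge0$, the $m$-ary trivial system of breadth $p$ is $$\Omega_m^{(p)}=\bigl(\{S\in\mathcal M(A^m): |S|\le p\},\ \{(x,S)\in A^m\times\mathcal M(A^m): |S|\le p-1\}\bigr).$$ The $m$-ary empty system is $(\emptyset,\emptyset)$. The $m$-ary equality system is $(E_m,\{(a,\dots,a):a\in A\}\times E_m)$, where $E_m$ is the set of finite multisets all of whose elements are constant $m$-tuples. The quotient $(\Phi,\Phi')/S$ of an $m$-ary system by $S\in\mathcal M(A^m)$ is $(\{S': S\uplus S'\in\Phi\},\{(x,S'):(x,S\uplus S')\in\Phi'\})$. Let $(\Phi_j,\Phi'_j)_{j\in J}$ be a nonempty family of systems of arities $n_j\ge1$, let $V$ be an arbitrary set disjoint from $\{0,1,2,\dots\}$, and let $h_j\colon\{0,\dots,n_j-1\}\to\{0,\dots,m-1\}\cup V$ $(j\in J)$ be maps,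 where $m\ge1$. For $a=(a_0,\dots,a_{m-1})\in A^m$ and $\sigma\colon V\to A$, let $(a+\sigma)h_j\in A^{n_j}$ be the tuple whose $i$-th entry is $a_{h_j(i)}$ if $h_j(i)\in\{0,\dots,m-1\}$ and $\sigma(h_j(i))$ if $h_j(i)\in V$. An $m$-ary system $(\Phi,\Phi')$ is a conjunctive minor of the family (via the maps $h_j$) if * for every $n\ge0$ and every $(a^1,\dots,a^n)\in A^{m\times n}$ with $(a^1,\dots,a^n)\prec\Phi$ there are $\sigma_1,\dots,\sigma_n\in A^V$ such that $((a^1+\sigma_1)h_j,\dots,(a^n+\sigma_n)h_j)\prec\Phi_j$ for all $j\in J$; and * for every $n\ge1$ and every $(a^1,\dots,a^n)\in A^{m\times n}$ for which there are $\sigma_1,\dots,\sigma_n\in A^V$ such that $((a^1+\sigma_1)h_j,\dots,(a^n+\sigma_n)h_j)\prec\Phi'_j$ for all $j\in J$, one has $(a^1,\dots,a^n)\prec\Phi'$. **Theorem.** For any set $W$ of systems of pointed multisets on $A$, the following are equivalent. (i) $W$ contains the binary equality system, the unary empty system, and the unary trivial systems $\Omega_1^{(p)}$ for all $p\ge0$,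 and moreover: * $W$ is locally closed: an $m$-ary system $(\Phi,\Phi')$ is in $W$ whenever $(\Phi,\Phi')\cap\Omega_m^{(p)}\in W$ for all $p\ge0$; * $W$ is closed under conjunctive minors: every conjunctive minor of a nonempty family of members of $W$ is in $W$; * $W$ is closed under unions: the union of a nonempty family of members of $W$ of a common arity is in $W$; * $W$ is closed under quotients: if $(\Phi,\Phi')\in W$ is $m$-ary, then $(\Phi,\Phi')/S\in W$ for every $S\in\mathcal M(A^m)$; * $W$ is closed under dividends: an $m$-ary system $(\Phi,\Phi')$ is in $W$ whenever there is $p\ge0$ such that $\Omega_m^{(p)}\subseteq(\Phi,\Phi')$ and $(\Phi,\Phi')/S\in W$ for every $S\in\mathcal M(A^m)$ with $|S|\ge p$. (ii) $W$ is characterized by some set $F$ of operations on $A$. -/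

import Mathlib

universe u

namespace PointedMultisets

/-- Operations on `A`: maps `A^n → A` with `n ≥ 1`. -/
abbrev Operation (A : Type u) : Type u :=
  Σ n : ℕ+, ((Fin n → A) → A)

/-- An `m`-ary system of pointed multisets on `A`. The antecedent is a set of finite multisets
on `A^m`, the consequent is a set of pointed multisets `(x, S)` on `A^m`. -/
@[ext]
structure PMSystem (A : Type u) (m : ℕ) where
  ante : Set (Multiset (Fin m → A))
  cons : Set ((Fin m → A) × Multiset (Fin m → A))
  down_closed : ∀ (x : Fin m → A) (S S' : Multiset (Fin m → A)),
    (x, S) ∈ cons → S' ≤ S → (x, S') ∈ cons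
  underlying_mem : ∀ (x : Fin m → A) (S : Multiset (Fin m → A)),
    (x, S) ∈ cons → {x} + S ∈ ante

/-- All systems of pointed multisets on `A`, of all arities `m ≥ 1`. -/
abbrev AnySystem (A : Type u) : Type u :=
  Σ m : ℕ+, PMSystem A m

section Matrices

variable {A : Type u} {m n : ℕ}

/-- The multiset of columns of an `m × n` matrix; a matrix is the tuple of its `n` columns. -/
def columns (M : Fin n → Fin m → A) : Multiset (Fin m → A) :=
  Finset.univ.val.map M

/-- `M ≺ Φ` for a set `Φ` of multisets. -/
def Prec (M : Fin n → Fin m → A) (Φ : Set (Multiset (Fin m → A))) : Prop :=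
  columns M ∈ Φ

/-- `M ≺ Φ'` for a set `Φ'` of pointed multisets and a matrix `M` with at least one column:
the first column is the point, the remaining columns form the multiset. -/
def PointedPrec (M : Fin (n + 1) → Fin m → A)
    (Φ' : Set ((Fin m → A) × Multiset (Fin m → A))) : Prop :=
  (M 0, columns (Fin.tail M)) ∈ Φ'

/-- The `m`-tuple `f M`, obtained by applying `f` to the rows of `M`. -/
def applyRows (f : (Fin n → A) → A) (M : Fin n → Fin m → A) : Fin m → A :=
  fun i => f (fun j => M j i)

/-- `f` preserves the system `Φ`: whenever `[M₁ | M₂] ≺ Φ.ante`, where `M₁` has as many columns as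
`f` has arguments and `M₂` may be empty, then `[f M₁ | M₂] ≺ Φ.cons`. -/
def Preserves (f : (Fin n → A) → A) (Φ : PMSystem A m) : Prop :=
  ∀ (k : ℕ) (M₁ : Fin n → Fin m → A) (M₂ : Fin k → Fin m → A),
    Prec (Fin.append M₁ M₂) Φ.ante →
      PointedPrec (Fin.cons (applyRows f M₁) M₂ : Fin (k + 1) → Fin m → A) Φ.cons

end Matrices

/-- The systems preserved by every operation in `F`. -/
def invariants {A : Type u} (F : Set (Operation A)) : Set (AnySystem A) :=
  {Φ | ∀ f ∈ F, Preserves f.2 Φ.2}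

/-- `W` is characterized by the set `F` of operations. -/
def IsCharacterizedBy {A : Type u} (W : Set (AnySystem A)) (F : Set (Operation A)) : Prop :=
  W = invariants F

namespace PMSystem

variable {A : Type u} {m : ℕ}

/-- Componentwise inclusion. -/
instance : LE (PMSystem A m) :=
  ⟨fun Φ Ψ => Φ.ante ⊆ Ψ.ante ∧ Φ.cons ⊆ Ψ.cons⟩

/-- The `m`-ary empty system `(∅, ∅)`. -/
def empty (A : Type u) (m : ℕ) : PMSystem A m where
  ante := ∅
  cons := ∅
  down_closed := fun _ _ _ h _ => h.elim
  underlying_mem := fun _ _ h => h.elim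

/-- The `m`-ary trivial system of breadth `p`: all multisets of cardinality at most `p` and
all pointed multisets `(x, S)` of cardinality `|S| + 1` at most `p`. -/
def trivialOfBreadth (A : Type u) (m p : ℕ) : PMSystem A m where
  ante := {S | S.card ≤ p}
  cons := {P | P.2.card + 1 ≤ p}
  down_closed := fun _ _ _ h hS =>
    le_trans (Nat.add_le_add_right (Multiset.card_le_card hS) 1) h
  underlying_mem := fun x S h => by
    simp only [Set.mem_ofPred_eq, Multiset.card_add, Multiset.card_singleton] at h ⊢
    omega

/-- The multisets on `A^m` all of whose members are constant tuples. -/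
def constantMultisets (A : Type u) (m : ℕ) : Set (Multiset (Fin m → A)) :=
  {S | ∀ a ∈ S, ∀ i j, a i = a j}

/-- The `m`-ary equality system. -/
def equality (A : Type u) (m : ℕ) : PMSystem A m where
  ante := constantMultisets A m
  cons := {x | ∃ c : A, x = fun _ => c} ×ˢ constantMultisets A m
  down_closed := fun _ _ _ h hS => ⟨h.1, fun a ha => h.2 a (Multiset.mem_of_le hS ha)⟩
  underlying_mem := fun x S h a ha i j => by
    rcases Multiset.mem_add.1 ha with ha | ha
    · obtain ⟨c, hc⟩ := h.1
      have hax : a = x := Multiset.mem_singleton.1 ha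
      have hxc : x = fun _ => c := hc
      rw [hax, hxc]
    · exact h.2 a ha i j

/-- Componentwise union of a family of systems of common arity. -/
def iUnion {J : Type u} (Φ : J → PMSystem A m) : PMSystem A m where
  ante := ⋃ j, (Φ j).ante
  cons := ⋃ j, (Φ j).cons
  down_closed := fun x S S' h hS => by
    obtain ⟨j, hj⟩ := Set.mem_iUnion.1 h
    exact Set.mem_iUnion.2 ⟨j, (Φ j).down_closed x S S' hj hS⟩
  underlying_mem := fun x S h => by
    obtain ⟨j, hj⟩ := Set.mem_iUnion.1 h
    exact Set.mem_iUnion.2 ⟨j, (Φ j).underlying_mem x S hj⟩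

/-- The quotient of a system by the multiset `S`. -/
def quotient (Φ : PMSystem A m) (S : Multiset (Fin m → A)) : PMSystem A m where
  ante := {S' | S + S' ∈ Φ.ante}
  cons := {P | (P.1, S + P.2) ∈ Φ.cons}
  down_closed := fun x T T' h hT =>
    Φ.down_closed x (S + T) (S + T') h (Multiset.add_le_add_left hT)
  underlying_mem := fun x T h => by
    have := Φ.underlying_mem x (S + T) h
    rwa [add_left_comm] at this

/-- The system obtained by restricting the breadth to `p`, that is, by intersecting
componentwise with the trivial system of breadth `p`. -/
def restrictBreadth (Φ : PMSystem A m) (p : ℕ) : PMSystem A m where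
  ante := Φ.ante ∩ (trivialOfBreadth A m p).ante
  cons := Φ.cons ∩ (trivialOfBreadth A m p).cons
  down_closed := fun x S S' h hS =>
    ⟨Φ.down_closed x S S' h.1 hS, (trivialOfBreadth A m p).down_closed x S S' h.2 hS⟩
  underlying_mem := fun x S h =>
    ⟨Φ.underlying_mem x S h.1, (trivialOfBreadth A m p).underlying_mem x S h.2⟩

end PMSystem

section Minors

variable {A V J : Type u} {m : ℕ+} {n : J → ℕ+}

/-- The tuple `(a + σ) h`, where `h` sends each index either to an index of `a` or to an
indeterminate, whose value is given by the Skolem map `σ`. -/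
def substitute {l k : ℕ} (h : Fin k → Fin l ⊕ V) (a : Fin l → A) (σ : V → A) : Fin k → A :=
  fun i => Sum.elim a σ (h i)

/-- `Φ` is a restrictive conjunctive minor of the family `Φs` of sets of multisets via the minor
formation scheme `h` with target `m`, indeterminate set `V` and source family `n`. -/
def IsRestrictiveMinor (h : ∀ j, Fin (n j) → Fin m ⊕ V) (Φ : Set (Multiset (Fin m → A)))
    (Φs : ∀ j, Set (Multiset (Fin (n j) → A))) : Prop :=
  ∀ (k : ℕ) (M : Fin k → Fin m → A), Prec M Φ →
    ∃ σ : Fin k → V → A, ∀ j, Prec (fun i => substitute (h j) (M i) (σ i)) (Φs j)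

/-- `Φ` is an extensive conjunctive minor of the family `Φs` of sets of pointed multisets via the
scheme `h`. -/
def IsExtensivePointedMinor (h : ∀ j, Fin (n j) → Fin m ⊕ V)
    (Φ : Set ((Fin m → A) × Multiset (Fin m → A)))
    (Φs : ∀ j, Set ((Fin (n j) → A) × Multiset (Fin (n j) → A))) : Prop :=
  ∀ (k : ℕ) (M : Fin (k + 1) → Fin m → A),
    (∃ σ : Fin (k + 1) → V → A,
      ∀ j, PointedPrec (fun i => substitute (h j) (M i) (σ i)) (Φs j)) →
    PointedPrec M Φ

/-- `Φ` is a conjunctive minor of the family `Φs` of systems via the scheme `h`. -/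
def IsConjunctiveMinor (h : ∀ j, Fin (n j) → Fin m ⊕ V) (Φ : PMSystem A m)
    (Φs : ∀ j, PMSystem A (n j)) : Prop :=
  IsRestrictiveMinor h Φ.ante (fun j => (Φs j).ante) ∧
    IsExtensivePointedMinor h Φ.cons (fun j => (Φs j).cons)

end Minors

section Closure

variable {A : Type u}

/-- Closure under conjunctive minors of nonempty families, of any index set `J` and via any
scheme, with any set `V` of indeterminates. -/
def ClosedUnderConjunctiveMinors (W : Set (AnySystem A)) : Prop :=
  ∀ (J : Type u) (_ : Nonempty J) (V : Type u) (m : ℕ+) (n : J → ℕ+)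
    (h : ∀ j, Fin (n j) → Fin m ⊕ V) (Φs : ∀ j, PMSystem A (n j)) (Φ : PMSystem A m),
    (∀ j, (⟨n j, Φs j⟩ : AnySystem A) ∈ W) → IsConjunctiveMinor h Φ Φs →
      (⟨m, Φ⟩ : AnySystem A) ∈ W

/-- Closure under unions of nonempty families of systems of a common arity. -/
def ClosedUnderUnions (W : Set (AnySystem A)) : Prop :=
  ∀ (J : Type u) (_ : Nonempty J) (m : ℕ+) (Φs : J → PMSystem A m),
    (∀ j, (⟨m, Φs j⟩ : AnySystem A) ∈ W) → (⟨m, PMSystem.iUnion Φs⟩ : AnySystem A) ∈ W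

def ClosedUnderQuotients (W : Set (AnySystem A)) : Prop :=
  ∀ (m : ℕ+) (Φ : PMSystem A m), (⟨m, Φ⟩ : AnySystem A) ∈ W →
    ∀ S : Multiset (Fin m → A), (⟨m, Φ.quotient S⟩ : AnySystem A) ∈ W

def ClosedUnderDividends (W : Set (AnySystem A)) : Prop :=
  ∀ (m : ℕ+) (Φ : PMSystem A m) (p : ℕ), PMSystem.trivialOfBreadth A m p ≤ Φ →
    (∀ S : Multiset (Fin m → A), p ≤ S.card → (⟨m, Φ.quotient S⟩ : AnySystem A) ∈ W) →
      (⟨m, Φ⟩ : AnySystem A) ∈ W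

def LocallyClosed (W : Set (AnySystem A)) : Prop :=
  ∀ (m : ℕ+) (Φ : PMSystem A m),
    (∀ p : ℕ, (⟨m, Φ.restrictBreadth p⟩ : AnySystem A) ∈ W) → (⟨m, Φ⟩ : AnySystem A) ∈ W

end Closure

end PointedMultisets

namespace PointedMultisets

/-! ### Matrices as multisets of columns -/

section Columns

/-! Closure of an invariant set is routine. Conversely, take `F` to be the polymorphisms of `W`; a
system `Φ` they all preserve must be shown to lie in `W`. `W` is closed under relaxation (smaller
antecedent, larger consequent: `mem_of_subset`). By local closure `Φ` may be cut to some breadth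
`p`, and then `Φ ∪ Ω^(p)` is a relaxation of `Ω^(p)`. One descends from `Φ ∪ Ω^(q+1)` to `Φ ∪ Ω^(q)`
by dividends: for `|S| ≥ q` the two quotients by `S` differ, in the direction that matters, only
within `Ω^(1)`. It remains to remove `Ω^(1)`, in `mem_of_union_trivialOfBreadth_one_mem`. That is a
Galois argument (`exists_mem_separating`): for each matrix `M ≺ Φ` a conjunctive minor whose Skolem
maps are operations `σ` forces a pointed multiset outside `Φ'` to be `(σM, ε)`, and excludes it
because such a `σ` violates some member of `W`. The union of these minors relaxes to `Φ`. -/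

theorem exists_map_eq_of_le_map {α β : Type*} {f : α → β} {R : Multiset α} {T : Multiset β}
    (h : T ≤ R.map f) : ∃ R' ≤ R, R'.map f = T := by
  induction R using Quotient.inductionOn
  induction T using Quotient.inductionOn
  obtain ⟨l, hl, hs⟩ := h
  obtain ⟨l', hl', rfl⟩ := List.sublist_map_iff.1 hs
  exact ⟨l', hl'.subperm, Quot.sound hl⟩

/-- Turns a multiset of pairs (column, Skolem map) back into one Skolem map per column, in the order
of the matrix. -/
theorem exists_section_of_map_fst {α β : Type*} {k : ℕ} (M : Fin k → α) (R : Multiset (α × β))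
    (h : R.map Prod.fst = Finset.univ.val.map M) :
    ∃ σ : Fin k → β, R = Finset.univ.val.map fun i => (M i, σ i) := by
  classical
  induction k generalizing R with
  | zero =>
    refine ⟨Fin.elim0, ?_⟩
    simpa using h
  | succ k ih =>
    have hM : Finset.univ.val.map M = M 0 ::ₘ Finset.univ.val.map (Fin.tail M) := by
      simp [Fin.univ_val_map, List.ofFn_succ, Fin.tail_def]
    obtain ⟨⟨a, b⟩, hr, ha, hR⟩ := (Multiset.map_eq_cons _ _ _ _).2 (h.trans hM)
    obtain ⟨σ, hσ⟩ := ih (Fin.tail M) _ hR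
    refine ⟨Fin.cons b σ, ?_⟩
    rw [← Multiset.cons_erase hr, hσ]
    obtain rfl : a = M 0 := ha
    simp [Fin.univ_val_map, List.ofFn_succ, Fin.tail_def]

variable {A : Type*} {m n k : ℕ}

theorem card_columns (M : Fin n → Fin m → A) : (columns M).card = n := by
  simp [columns]

theorem columns_append (M₁ : Fin n → Fin m → A) (M₂ : Fin k → Fin m → A) :
    columns (Fin.append M₁ M₂) = columns M₁ + columns M₂ := by
  simp [columns, Fin.univ_val_map, List.ofFn_fin_append]

theorem exists_columns_eq (S : Multiset (Fin m → A)) :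
    ∃ (k : ℕ) (M : Fin k → Fin m → A), columns M = S := by
  induction S using Quotient.inductionOn with
  | h l => exact ⟨l.length, l.get, by simp [columns, Fin.univ_val_map]⟩

end Columns

/-! ### Closure properties of the systems preserved by one operation -/

section Preservation

variable {A : Type u} {m n : ℕ} {f : (Fin n → A) → A}

theorem preserves_iff {Φ : PMSystem A m} :
    Preserves f Φ ↔ ∀ (M : Fin n → Fin m → A) (T : Multiset (Fin m → A)),
      columns M + T ∈ Φ.ante → (applyRows f M, T) ∈ Φ.cons := by
  constructor
  · intro h M T hT
    obtain ⟨k, M₂, rfl⟩ := exists_columns_eq T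
    have := h k M M₂ (by rwa [Prec, columns_append])
    simpa [PointedPrec] using this
  · intro h k M₁ M₂ hM
    rw [Prec, columns_append] at hM
    simpa [PointedPrec] using h M₁ _ hM

theorem preserves_empty : Preserves f (PMSystem.empty A m) :=
  fun _ _ _ h => h.elim

theorem preserves_trivialOfBreadth (hn : 0 < n) (p : ℕ) :
    Preserves f (PMSystem.trivialOfBreadth A m p) := by
  refine preserves_iff.2 fun M T hT => ?_
  have hT' : (columns M + T).card ≤ p := hT
  rw [Multiset.card_add, card_columns] at hT'
  change T.card + 1 ≤ p
  omega

theorem preserves_equality (hm : 0 < m) : Preserves f (PMSystem.equality A m) := by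
  refine preserves_iff.2 fun M T hT => ⟨⟨f fun j => M j ⟨0, hm⟩, ?_⟩, ?_⟩
  · funext i
    refine congrArg f (funext fun j => ?_)
    refine hT (M j) (Multiset.mem_add.2 (Or.inl ?_)) _ _
    exact Multiset.mem_map_of_mem M (Finset.mem_univ j)
  · exact fun a ha => hT a (Multiset.mem_add.2 (Or.inr ha))

theorem Preserves.quotient {Φ : PMSystem A m} (h : Preserves f Φ) (S : Multiset (Fin m → A)) :
    Preserves f (Φ.quotient S) := by
  refine preserves_iff.2 fun M T hT => ?_
  refine preserves_iff.1 h M (S + T) ?_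
  rw [add_left_comm]
  exact hT

theorem preserves_of_quotient {Φ : PMSystem A m} (p : ℕ)
    (hp : PMSystem.trivialOfBreadth A m p ≤ Φ)
    (h : ∀ S : Multiset (Fin m → A), p ≤ S.card → Preserves f (Φ.quotient S)) :
    Preserves f Φ := by
  refine preserves_iff.2 fun M T hT => ?_
  rcases le_or_gt p T.card with hpT | hpT
  -- Dividing by `T` itself leaves nothing beside the columns of `M`.
  · have := preserves_iff.1 (h T hpT) M 0 (by
      change T + (columns M + 0) ∈ Φ.ante
      rwa [add_zero, add_comm])
    change (_, T + 0) ∈ Φ.cons at this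
    rwa [add_zero] at this
  · exact hp.2 (show T.card + 1 ≤ p from hpT)

theorem preserves_iUnion {J : Type u} {Φ : J → PMSystem A m} (h : ∀ j, Preserves f (Φ j)) :
    Preserves f (PMSystem.iUnion Φ) := by
  refine preserves_iff.2 fun M T hT => ?_
  obtain ⟨j, hj⟩ := Set.mem_iUnion.1 hT
  exact Set.mem_iUnion.2 ⟨j, preserves_iff.1 (h j) M T hj⟩

theorem Preserves.restrictBreadth {Φ : PMSystem A m} (hn : 0 < n) (h : Preserves f Φ) (p : ℕ) :
    Preserves f (Φ.restrictBreadth p) :=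
  preserves_iff.2 fun M T hT => ⟨preserves_iff.1 h M T hT.1,
    preserves_iff.1 (preserves_trivialOfBreadth hn p) M T hT.2⟩

theorem preserves_of_restrictBreadth {Φ : PMSystem A m}
    (h : ∀ p, Preserves f (Φ.restrictBreadth p)) : Preserves f Φ :=
  preserves_iff.2 fun M T hT => (preserves_iff.1 (h (columns M + T).card) M T
    ⟨hT, le_refl (columns M + T).card⟩).1

theorem applyRows_substitute {V : Type u} {l : ℕ} (h : Fin l → Fin m ⊕ V)
    (M : Fin n → Fin m → A) (σ : Fin n → V → A) :
    applyRows f (fun j => substitute h (M j) (σ j)) =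
      substitute h (applyRows f M) (fun v => f fun j => σ j v) := by
  funext i
  simp only [applyRows, substitute]
  cases h i <;> rfl

/-- Substitution commutes with `f`, so applying `f` pointwise to the Skolem maps of `M₁` gives one
for `f M₁`; those of `M₂` are kept. -/
theorem preserves_of_isConjunctiveMinor {V J : Type u} {m : ℕ+} {l : J → ℕ+}
    {h : ∀ j, Fin (l j) → Fin m ⊕ V} {Φ : PMSystem A m} {Φs : ∀ j, PMSystem A (l j)}
    (hΦ : IsConjunctiveMinor h Φ Φs) (hf : ∀ j, Preserves f (Φs j)) : Preserves f Φ := by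
  intro k M₁ M₂ hM
  obtain ⟨σ, hσ⟩ := hΦ.1 _ _ hM
  refine hΦ.2 _ _ ⟨Fin.cons (fun v => f fun j => σ (Fin.castAdd k j) v)
    fun i => σ (Fin.natAdd n i), fun j => ?_⟩
  have key := hf j k (fun i => substitute (h j) (M₁ i) (σ (Fin.castAdd k i)))
    (fun i => substitute (h j) (M₂ i) (σ (Fin.natAdd n i))) (by
      convert hσ j using 1
      funext i
      refine Fin.addCases (fun i => ?_) (fun i => ?_) i <;> simp)
  rw [applyRows_substitute] at key
  simpa [PointedPrec, Fin.tail_def] using key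

end Preservation

/-! ### Tight conjunctive minors -/

section Minors

variable {A V J : Type u} {m : ℕ+}

/-- The conjunctive minor of a family via a scheme with the largest antecedent and the smallest
consequent. -/
def tightMinor {l : J → ℕ+} (h : ∀ j, Fin (l j) → Fin m ⊕ V) (Φs : ∀ j, PMSystem A (l j)) :
    PMSystem A m where
  ante := {S | ∃ R : Multiset ((Fin m → A) × (V → A)), R.map Prod.fst = S ∧
    ∀ j, R.map (fun r => substitute (h j) r.1 r.2) ∈ (Φs j).ante}
  cons := {P | ∃ (σ : V → A) (R : Multiset ((Fin m → A) × (V → A))), R.map Prod.fst = P.2 ∧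
    ∀ j, (substitute (h j) P.1 σ, R.map (fun r => substitute (h j) r.1 r.2)) ∈ (Φs j).cons}
  down_closed := by
    rintro x S S' ⟨σ, R, rfl, hR⟩ hS
    obtain ⟨R', hR', h'⟩ := exists_map_eq_of_le_map hS
    exact ⟨σ, R', h', fun j => (Φs j).down_closed _ _ _ (hR j) (Multiset.map_le_map hR')⟩
  underlying_mem := by
    rintro x S ⟨σ, R, rfl, hR⟩
    refine ⟨{(x, σ)} + R, by simp, fun j => ?_⟩
    simpa using (Φs j).underlying_mem _ _ (hR j)

theorem isConjunctiveMinor_tightMinor {l : J → ℕ+} (h : ∀ j, Fin (l j) → Fin m ⊕ V)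
    (Φs : ∀ j, PMSystem A (l j)) : IsConjunctiveMinor h (tightMinor h Φs) Φs := by
  constructor
  · rintro k M ⟨R, hR, hj⟩
    obtain ⟨σ, rfl⟩ := exists_section_of_map_fst M R hR
    refine ⟨σ, fun j => ?_⟩
    simpa [Prec, columns, Multiset.map_map, Function.comp_def] using hj j
  · rintro k M ⟨σ, hσ⟩
    refine ⟨σ 0, Finset.univ.val.map fun i : Fin k => (M i.succ, σ i.succ), ?_, fun j => ?_⟩
    · simp [columns, Fin.tail_def, Function.comp_def]
    · simpa [PointedPrec, columns, Fin.tail_def, Multiset.map_map, Function.comp_def] using hσ j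

end Minors

/-! ### From closure conditions to invariants of polymorphisms -/

section Closed

variable {A : Type u} {W : Set (AnySystem A)}

theorem ClosedUnderConjunctiveMinors.mem_of_substitute (hW : ClosedUnderConjunctiveMinors W)
    {m l : ℕ+} {Φ : PMSystem A m} {Ψ : PMSystem A l} (h : Fin l → Fin m) (hΨ : ⟨l, Ψ⟩ ∈ W)
    (hante : ∀ S ∈ Φ.ante, S.map (· ∘ h) ∈ Ψ.ante)
    (hcons : ∀ x S, (x ∘ h, S.map (· ∘ h)) ∈ Ψ.cons → (x, S) ∈ Φ.cons) : ⟨m, Φ⟩ ∈ W := by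
  refine hW PUnit ⟨⟨⟩⟩ PEmpty m (fun _ => l) (fun _ i => Sum.inl (h i)) (fun _ => Ψ) Φ
    (fun _ => hΨ) ⟨fun k M hM => ⟨fun _ => PEmpty.elim, fun _ => ?_⟩, ?_⟩
  · have := hante _ hM
    rwa [columns, Multiset.map_map] at this
  · rintro k M ⟨σ, hσ⟩
    refine hcons _ _ ?_
    rw [columns, Multiset.map_map]
    exact hσ ⟨⟩

theorem ClosedUnderConjunctiveMinors.mem_of_subset (hW : ClosedUnderConjunctiveMinors W)
    {m : ℕ+} {Φ Ψ : PMSystem A m} (hΨ : ⟨m, Ψ⟩ ∈ W) (hante : Φ.ante ⊆ Ψ.ante)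
    (hcons : Ψ.cons ⊆ Φ.cons) : ⟨m, Φ⟩ ∈ W :=
  hW.mem_of_substitute id hΨ (fun S hS => by simpa using hante hS)
    (fun x S h => hcons (by simpa using h))

theorem empty_mem (hW : ClosedUnderConjunctiveMinors W)
    (h1 : (⟨1, PMSystem.empty A _⟩ : AnySystem A) ∈ W) (m : ℕ+) : ⟨m, PMSystem.empty A m⟩ ∈ W :=
  hW.mem_of_substitute (fun _ => ⟨0, m.pos⟩) h1 (fun _ h => h.elim) (fun _ _ h => h.elim)

theorem trivialOfBreadth_mem (hW : ClosedUnderConjunctiveMinors W) {p : ℕ}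
    (h1 : (⟨1, PMSystem.trivialOfBreadth A _ p⟩ : AnySystem A) ∈ W) (m : ℕ+) :
    ⟨m, PMSystem.trivialOfBreadth A m p⟩ ∈ W :=
  hW.mem_of_substitute (fun _ => ⟨0, m.pos⟩) h1
    (fun S h => (Multiset.card_map _ S).trans_le h)
    (fun _ S h => (congrArg (· + 1) (Multiset.card_map _ S)).symm.trans_le h)

/-- The union of two systems. -/
def PMSystem.union {m : ℕ} (Φ Ψ : PMSystem A m) : PMSystem A m :=
  PMSystem.iUnion fun b : ULift.{u} Bool => bif b.down then Φ else Ψ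

theorem PMSystem.union_ante {m : ℕ} (Φ Ψ : PMSystem A m) :
    (Φ.union Ψ).ante = Φ.ante ∪ Ψ.ante := by
  ext S
  simp [PMSystem.union, PMSystem.iUnion, or_comm]

theorem PMSystem.union_cons {m : ℕ} (Φ Ψ : PMSystem A m) :
    (Φ.union Ψ).cons = Φ.cons ∪ Ψ.cons := by
  ext S
  simp [PMSystem.union, PMSystem.iUnion, or_comm]

theorem Preserves.union {m n : ℕ} {f : (Fin n → A) → A} {Φ Ψ : PMSystem A m}
    (hΦ : Preserves f Φ) (hΨ : Preserves f Ψ) : Preserves f (Φ.union Ψ) :=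
  preserves_iUnion (by rintro ⟨_ | _⟩ <;> assumption)

theorem ClosedUnderUnions.union_mem (hW : ClosedUnderUnions W) {m : ℕ+} {Φ Ψ : PMSystem A m}
    (hΦ : ⟨m, Φ⟩ ∈ W) (hΨ : ⟨m, Ψ⟩ ∈ W) : ⟨m, Φ.union Ψ⟩ ∈ W :=
  hW _ ⟨⟨true⟩⟩ _ _ (by rintro ⟨_ | _⟩ <;> assumption)

/-- The operations preserving every system in `W`. -/
def polymorphisms (W : Set (AnySystem A)) : Set (Operation A) :=
  {f | ∀ Φ ∈ W, Preserves f.2 Φ.2}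

/-- Quotients absorb the columns left untouched by `f`, so a failure can be taken with empty
remainder. -/
theorem exists_not_preserved (hquot : ClosedUnderQuotients W) {f : Operation A}
    (hf : f ∉ polymorphisms W) :
    ∃ Ψ ∈ W, ∃ M : Fin f.1 → Fin Ψ.1 → A,
      columns M ∈ Ψ.2.ante ∧ (applyRows f.2 M, 0) ∉ Ψ.2.cons := by
  simp only [polymorphisms, Set.mem_ofPred_eq, not_forall] at hf
  obtain ⟨Ψ, hΨ, hf⟩ := hf
  simp only [preserves_iff, not_forall] at hf
  obtain ⟨M, T, hT, hcons⟩ := hf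
  refine ⟨⟨Ψ.1, Ψ.2.quotient T⟩, hquot _ _ hΨ T, M, ?_, ?_⟩
  · change T + columns M ∈ Ψ.2.ante
    rwa [add_comm]
  · change (_, T + 0) ∉ Ψ.2.cons
    rwa [add_zero]

/-- If the polymorphisms of `W` preserve `Φ` and `Φ` joined with the trivial system of breadth one
is in `W`, then a member of `W` whose antecedent contains the columns of `M` has its consequent
inside that of `Φ`. Its indeterminates are the possible rows of a matrix with `N` columns, so that
Skolem maps are the `N`-ary operations. -/
theorem exists_mem_separating (hminor : ClosedUnderConjunctiveMinors W)
    (hquot : ClosedUnderQuotients W) (heq : (⟨2, PMSystem.equality A _⟩ : AnySystem A) ∈ W)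
    {m : ℕ+} {Φ : PMSystem A m} (hΦ : ∀ f ∈ polymorphisms W, Preserves f.2 Φ)
    (hunion : ⟨m, Φ.union (PMSystem.trivialOfBreadth A m 1)⟩ ∈ W)
    {N : ℕ+} (M : Fin N → Fin m → A) (hM : columns M ∈ Φ.ante) :
    ∃ Ψ : PMSystem A m, ⟨m, Ψ⟩ ∈ W ∧ columns M ∈ Ψ.ante ∧ Ψ.cons ⊆ Φ.cons := by
  let B : Type u := {f : (Fin N → A) → A // (applyRows f M, 0) ∉ Φ.cons}
  have hB : ∀ f : B, ∃ Ψ ∈ W, ∃ M' : Fin N → Fin Ψ.1 → A,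
      columns M' ∈ Ψ.2.ante ∧ (applyRows f.1 M', 0) ∉ Ψ.2.cons := by
    intro f
    refine exists_not_preserved hquot (f := ⟨N, f.1⟩) fun hf => f.2 ?_
    exact preserves_iff.1 (hΦ _ hf) M 0 (by rwa [add_zero])
  choose Ψ hΨ M' hante hcons using hB
  let J : Type u := PUnit.{u + 1} ⊕ ULift.{u} (Fin m) ⊕ B
  -- Three kinds of sources: one bounds the consequent by `Φ ∪ Ω^(1)`, the equalities tie coordinate
  -- `i` to the indeterminate that is row `i` of `M`, and the last rule out each bad operation.
  let c : J → Σ Θ : AnySystem A, Fin Θ.1 → Fin m ⊕ (Fin N → A) :=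
    Sum.elim (fun _ => ⟨⟨m, Φ.union (PMSystem.trivialOfBreadth A m 1)⟩, Sum.inl⟩)
      (Sum.elim (fun i => ⟨⟨2, PMSystem.equality A _⟩,
          Fin.cons (Sum.inl i.down) fun _ => Sum.inr fun j => M j i.down⟩)
        (fun f => ⟨Ψ f, fun i => Sum.inr fun j => M' f j i⟩))
  have hcW : ∀ j, (c j).1 ∈ W := by
    rintro (_ | _ | f)
    exacts [hunion, heq, hΨ f]
  refine ⟨tightMinor (fun j => (c j).2) (fun j => (c j).1.2),
    hminor J ⟨Sum.inl ⟨⟩⟩ (Fin N → A) m _ _ _ _ hcW (isConjunctiveMinor_tightMinor _ _), ?_, ?_⟩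
  -- The Skolem map of column `j` is the `j`-th projection, which recovers `M` and each `M' f`.
  · refine ⟨Finset.univ.val.map fun j => (M j, fun v => v j), ?_, ?_⟩
    · simp [columns, Function.comp_def]
    · rintro (_ | i | f)
      · rw [Multiset.map_map]
        change columns M ∈ (Φ.union _).ante
        rw [PMSystem.union_ante]
        exact Or.inl hM
      · rw [Multiset.map_map]
        intro a ha
        obtain ⟨j, -, rfl⟩ := Multiset.mem_map.1 ha
        have hconst : ∀ i' : Fin 2, substitute (Fin.cons (Sum.inl i.down)
            fun _ => Sum.inr fun j => M j i.down : Fin 2 → Fin m ⊕ (Fin N → A)) (M j)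
            (fun v => v j) i' = M j i.down := by
          intro i'
          refine Fin.cases ?_ (fun _ => ?_) i' <;> simp [substitute]
        exact fun i₁ i₂ => (hconst i₁).trans (hconst i₂).symm
      · rw [Multiset.map_map]
        exact hante f
  · rintro ⟨x, T⟩ ⟨σ, R, rfl, hR⟩
    have h0 : (x, R.map Prod.fst) ∈ (Φ.union (PMSystem.trivialOfBreadth A m 1)).cons :=
      hR (Sum.inl ⟨⟩)
    rw [PMSystem.union_cons] at h0
    rcases h0 with h0 | h0
    · exact h0
    · have hR0 : R = 0 := by
        have : (R.map Prod.fst).card + 1 ≤ 1 := h0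
        rw [Multiset.card_map] at this
        exact Multiset.card_eq_zero.1 (by omega)
      subst hR0
      -- The equality sources compare `x i` with `σ` at row `i` of `M`.
      have hx : x = applyRows σ M := by
        funext i
        obtain ⟨⟨a, ha⟩, -⟩ := hR (Sum.inr (Sum.inl ⟨i⟩))
        exact (congrFun ha (0 : Fin 2)).trans (congrFun ha (1 : Fin 2)).symm
      by_contra hx'
      subst hx
      exact hcons ⟨σ, hx'⟩ (hR (Sum.inr (Sum.inr ⟨σ, hx'⟩)))

theorem mem_of_union_trivialOfBreadth_one_mem (hminor : ClosedUnderConjunctiveMinors W)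
    (hunions : ClosedUnderUnions W) (hquot : ClosedUnderQuotients W)
    (heq : (⟨2, PMSystem.equality A _⟩ : AnySystem A) ∈ W)
    (hempty : (⟨1, PMSystem.empty A _⟩ : AnySystem A) ∈ W)
    (htriv : ∀ p : ℕ, (⟨1, PMSystem.trivialOfBreadth A _ p⟩ : AnySystem A) ∈ W)
    {m : ℕ+} {Φ : PMSystem A m} (hΦ : ∀ f ∈ polymorphisms W, Preserves f.2 Φ)
    (hunion : ⟨m, Φ.union (PMSystem.trivialOfBreadth A m 1)⟩ ∈ W) : ⟨m, Φ⟩ ∈ W := by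
  -- Only nonempty unions are available, hence the separate case.
  rcases Set.eq_empty_or_nonempty Φ.ante with h | ⟨S₀, hS₀⟩
  · exact hminor.mem_of_subset (empty_mem hminor hempty m) h.subset (Set.empty_subset _)
  have key : ∀ S : Φ.ante, ∃ Ψ : PMSystem A m,
      ⟨m, Ψ⟩ ∈ W ∧ S.1 ∈ Ψ.ante ∧ Ψ.cons ⊆ Φ.cons := by
    rintro ⟨S, hS⟩
    obtain ⟨N, M, rfl⟩ := exists_columns_eq S
    rcases Nat.eq_zero_or_pos N with rfl | hN
    -- Operations have positive arity, so `ε` is handled by `Ω^(0)`, whose consequent is empty.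
    · refine ⟨_, trivialOfBreadth_mem hminor (htriv 0) m, (card_columns M).le, ?_⟩
      exact fun P (hP : P.2.card + 1 ≤ 0) => absurd hP (by omega)
    · exact exists_mem_separating hminor hquot heq hΦ hunion (N := ⟨N, hN⟩) M hS
  choose Ψ hW hante hcons using key
  refine hminor.mem_of_subset (hunions Φ.ante ⟨⟨S₀, hS₀⟩⟩ m Ψ hW) ?_ ?_
  · exact fun S hS => Set.mem_iUnion.2 ⟨⟨S, hS⟩, hante _⟩
  · exact Set.iUnion_subset hcons

/-- If `(x, S + T)` has breadth at most `q + 1` and `|S| ≥ q`, then `T` is empty, so `(x, T)`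
already lies in `Ω^(1)`. -/
theorem union_quotient_union_subset {m : ℕ} (Φ : PMSystem A m) {q : ℕ}
    {S : Multiset (Fin m → A)} (hS : q ≤ S.card) :
    let Ω := PMSystem.trivialOfBreadth A m
    (((Φ.union (Ω q)).quotient S).union (Ω 1)).ante ⊆
        (((Φ.union (Ω (q + 1))).quotient S).union (Ω 1)).ante ∧
      (((Φ.union (Ω (q + 1))).quotient S).union (Ω 1)).cons ⊆
        (((Φ.union (Ω q)).quotient S).union (Ω 1)).cons := by
  simp only [PMSystem.union_ante, PMSystem.union_cons]
  constructor
  · rintro T (hT | hT)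
    · change S + T ∈ (Φ.union _).ante at hT
      rw [PMSystem.union_ante] at hT
      refine Or.inl ?_
      change S + T ∈ (Φ.union _).ante
      rw [PMSystem.union_ante]
      exact hT.imp_right fun h => Nat.le_succ_of_le h
    · exact Or.inr hT
  · rintro ⟨x, T⟩ (hT | hT)
    · change (x, S + T) ∈ (Φ.union _).cons at hT
      rw [PMSystem.union_cons] at hT
      rcases hT with hT | hT
      · refine Or.inl ?_
        change (x, S + T) ∈ (Φ.union _).cons
        rw [PMSystem.union_cons]
        exact Or.inl hT
      · have hT' : (S + T).card + 1 ≤ q + 1 := hT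
        rw [Multiset.card_add] at hT'
        exact Or.inr (show T.card + 1 ≤ 1 by omega)
    · exact Or.inr hT

theorem mem_of_preserves_polymorphisms (hlocal : LocallyClosed W)
    (heq : (⟨2, PMSystem.equality A _⟩ : AnySystem A) ∈ W)
    (hempty : (⟨1, PMSystem.empty A _⟩ : AnySystem A) ∈ W)
    (htriv : ∀ p : ℕ, (⟨1, PMSystem.trivialOfBreadth A _ p⟩ : AnySystem A) ∈ W)
    (hminor : ClosedUnderConjunctiveMinors W) (hunions : ClosedUnderUnions W)
    (hquot : ClosedUnderQuotients W) (hdiv : ClosedUnderDividends W)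
    {m : ℕ+} {Φ : PMSystem A m} (hΦ : ∀ f ∈ polymorphisms W, Preserves f.2 Φ) :
    ⟨m, Φ⟩ ∈ W := by
  refine hlocal m Φ fun p => ?_
  have hΦp : ∀ f ∈ polymorphisms W, Preserves f.2 (Φ.restrictBreadth p) :=
    fun f hf => (hΦ f hf).restrictBreadth f.1.pos p
  generalize hX : Φ.restrictBreadth p = X at hΦp ⊢
  have hXp : X ≤ PMSystem.trivialOfBreadth A m p := by
    rw [← hX]
    exact ⟨Set.inter_subset_right, Set.inter_subset_right⟩
  have step : ∀ q, ⟨m, X.union (PMSystem.trivialOfBreadth A m (q + 1))⟩ ∈ W →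
      ⟨m, X.union (PMSystem.trivialOfBreadth A m q)⟩ ∈ W := by
    intro q hq
    refine hdiv m _ q ⟨?_, ?_⟩ fun S hS => ?_
    · rw [PMSystem.union_ante]
      exact Set.subset_union_right
    · rw [PMSystem.union_cons]
      exact Set.subset_union_right
    · refine mem_of_union_trivialOfBreadth_one_mem hminor hunions hquot heq hempty htriv
        (fun f hf => ((hΦp f hf).union (preserves_trivialOfBreadth f.1.pos q)).quotient S) ?_
      exact hminor.mem_of_subset
        (hunions.union_mem (hquot m _ hq S) (trivialOfBreadth_mem hminor (htriv 1) m))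
        (union_quotient_union_subset X hS).1 (union_quotient_union_subset X hS).2
  have start : ⟨m, X.union (PMSystem.trivialOfBreadth A m p)⟩ ∈ W := by
    refine hminor.mem_of_subset (trivialOfBreadth_mem hminor (htriv p) m) ?_ ?_
    · rw [PMSystem.union_ante]
      exact Set.union_subset hXp.1 subset_rfl
    · rw [PMSystem.union_cons]
      exact Set.subset_union_right
  have hzero : ⟨m, X.union (PMSystem.trivialOfBreadth A m 0)⟩ ∈ W :=
    Nat.decreasingInduction (motive := fun q _ =>
      ⟨m, X.union (PMSystem.trivialOfBreadth A m q)⟩ ∈ W) (fun q _ => step q) start (Nat.zero_le p)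
  -- `Ω^(0)` adds at most `ε` to the antecedent and nothing to the consequent.
  refine hminor.mem_of_subset hzero ?_ ?_
  · rw [PMSystem.union_ante]
    exact Set.subset_union_left
  · rw [PMSystem.union_cons]
    exact Set.union_subset subset_rfl
      fun P (hP : P.2.card + 1 ≤ 0) => absurd hP (by omega)

end Closed

end PointedMultisets

theorem mainTheorem2 {A : Type*} [Nonempty A] (W : Set (PointedMultisets.AnySystem A)) :
    (PointedMultisets.LocallyClosed W ∧
      (⟨2, PointedMultisets.PMSystem.equality A _⟩ : PointedMultisets.AnySystem A) ∈ W ∧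
      (⟨1, PointedMultisets.PMSystem.empty A _⟩ : PointedMultisets.AnySystem A) ∈ W ∧
      (∀ p : ℕ, (⟨1, PointedMultisets.PMSystem.trivialOfBreadth A _ p⟩ :
        PointedMultisets.AnySystem A) ∈ W) ∧
      PointedMultisets.ClosedUnderConjunctiveMinors W ∧
      PointedMultisets.ClosedUnderUnions W ∧
      PointedMultisets.ClosedUnderQuotients W ∧
      PointedMultisets.ClosedUnderDividends W) ↔
    ∃ F : Set (PointedMultisets.Operation A), PointedMultisets.IsCharacterizedBy W F := by
  open PointedMultisets in
  constructor
  · rintro ⟨hlocal, heq, hempty, htriv, hminor, hunions, hquot, hdiv⟩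
    refine ⟨polymorphisms W, Set.Subset.antisymm (fun Φ hΦ f hf => hf Φ hΦ) fun Φ hΦ => ?_⟩
    exact mem_of_preserves_polymorphisms hlocal heq hempty htriv hminor hunions hquot hdiv hΦ
  · rintro ⟨F, rfl⟩
    refine ⟨?_, ?_, ?_, ?_, ?_, ?_, ?_, ?_⟩
    · exact fun m Φ h f hf => preserves_of_restrictBreadth fun p => h p f hf
    · exact fun f _ => preserves_equality (PNat.pos 2)
    · exact fun f _ => preserves_empty
    · exact fun p f _ => preserves_trivialOfBreadth f.1.pos p
    · exact fun J _ V m n h Φs Φ hΦs hΦ f hf =>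
        preserves_of_isConjunctiveMinor hΦ fun j => hΦs j f hf
    · exact fun J _ m Φs h f hf => preserves_iUnion fun j => h j f hf
    · exact fun m Φ h S f hf => (h f hf).quotient S
    · exact fun m Φ p hp h f hf =>
        preserves_of_quotient p hp fun S hS => h S hS f hf
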